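/- Let $G$ be a finite connected directed graph (multiple edges allowed, no looped edges) with base vertex $x_0$ and fundamental group $\pi=\pi_1(G,x_0)$. Let $f:G\to G$ be continuous, permute the vertices of $G$, and be homotopic to the identity, and let $\widetilde f$ be the lift of $f$ to the universal cover $\widetilde G$ obtained by lifting a homotopy from $\mathrm{id}_G$ to $f$, starting at $\mathrm{id}_{\widetilde G}$. Fix a spanning tree $\mathcal T$ of $G$. It makes $\pi$ a free group: each edge $D\notin\mathcal T$ gives the generator $\theta_D$ represented by the loop that runs in $\mathcal T$ from $x_0$ to the initial vertex of $D$, crosses $D$, and returns in $\mathcal T$; put $\theta_D=1$ for $D\in\mathcal T$. Elements of $\pi$ are regarded as reduced words in these generators and as covering transformations of $\widetilde G$ (with $(gh)\widetilde x=g(h\widetilde x)$). Label $\widetilde G$ coherently: lift $\mathcal T$ to a tree in $\widetilde G$, which gives a chosen lift $\widetilde V$ of every vertex $V$, and for every edge $D$ from $V$ to $V'$ let the chosen lift $\widetilde D$ be the lift of $D$ starting at $\widetilde V$; it ends at $\theta_D\widetilde V'$. For $x$ in the interior of an edge $D$, let $\widetilde x$ be the point of $\widetilde D$ above $x$. For $n\ge1$,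 a point $x$ with $f^n(x)=x$ has rotation element $\rho(x)=w^{1/n}$, $w\in\pi$, if $\widetilde f^{\,n}(\widetilde x)=w\widetilde x$. An edge $E$ belongs to $\alpha\in\pi$ if every cyclic reduction of $\alpha$ uses $E$ or $E^{-1}$, where a cyclic reduction of $\alpha$ is a cyclically reduced edge loop obtained from an edge loop representing $\alpha$ by changing the base point along the loop and cancelling adjacent inverse edges. Theorem. Let $E\in\mathcal T$ be an edge with initial vertex $V_1$ and terminal vertex $V_2$, and let $m,n\ge 1$ and $w_1,w_2\in\pi$ be such that $f^m(V_1)=V_1$, $\rho(V_1)=w_1^{1/m}$, $f^n(V_2)=V_2$ and $\rho(V_2)=w_2^{1/n}$. Suppose that $E$ belongs to both $w_1$ and $w_2$, and that $w_1,w_2$ are not powers of a common word (there are no $w\in\pi$ and $k_1,k_2\in\mathbb Z$ with $w_1=w^{k_1}$, $w_2=w^{k_2}$). Then there exist an initial subword $\gamma_1$ of $w_1$ and an initial subword $\gamma_2$ of $w_2$ such that for all rationals $r,s$ with $0<r<1/m$ and $0<s<1/n$ there exist positive integers $p,q,p',q'$ with $p/q=r$, $p'/q'=s$ and periodic points $x,y\in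 E$ with $f^q(x)=x$, $\rho(x)=(w_1^{p}\gamma_1)^{1/q}$ and $f^{q'}(y)=y$, $\rho(y)=(w_2^{p'}\gamma_2)^{1/q'}$. -/

import Mathlib

/-- A directed graph with vertices `V` and edges `E`; multiple edges are allowed. -/
structure DirGraph (V E : Type*) where
  /-- initial vertex of an edge -/
  src : E → V
  /-- terminal vertex of an edge -/
  tgt : E → V

namespace DirGraph

variable {V E : Type*}

section Combinatorics

/-- The first vertex of an oriented edge: `(e, true)` is `e`, and `(e, false)` is `e` reversed. -/
def first (G : DirGraph V E) (d : E × Bool) : V := if d.2 then G.src d.1 else G.tgt d.1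

/-- The last vertex of an oriented edge. -/
def last (G : DirGraph V E) (d : E × Bool) : V := if d.2 then G.tgt d.1 else G.src d.1

/-- `G.IsPath u v P`: the list `P` of oriented edges is an edge path from `u` to `v`. -/
def IsPath (G : DirGraph V E) (u v : V) : List (E × Bool) → Prop
  | [] => u = v
  | d :: P => G.first d = u ∧ G.IsPath (G.last d) v P

/-- `T` is (the edge set of) a spanning tree: any two vertices are joined by exactly one edge path
in `T` without backtracking. -/
def IsSpanningTree (G : DirGraph V E) (T : Set E) : Prop :=
  ∀ u v : V, ∃! P : List (E × Bool),
    G.IsPath u v P ∧ FreeGroup.IsReduced P ∧ ∀ d ∈ P, d.1 ∈ T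

/-- For a spanning tree `T`, the fundamental group of the graph is the free group on the edges
outside `T`. The generator of `e` is the class of the loop that runs inside `T` from the
base vertex to the initial vertex of `e`, crosses `e`, and runs back inside `T`. -/
abbrev Pi (T : Set E) : Type _ := FreeGroup {e : E // e ∉ T}

open Classical in
/-- The label `θ_e` of an edge: trivial on the spanning tree, a generator outside it. -/
noncomputable def theta (T : Set E) (e : E) : Pi T :=
  if h : e ∈ T then 1 else FreeGroup.of ⟨e, h⟩

/-- The element of the fundamental group read off from an edge path; for an edge loop at the base
vertex it is the class of that loop. -/
noncomputable def word (T : Set E) (P : List (E × Bool)) : Pi T :=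
  FreeGroup.lift (theta T) (FreeGroup.mk P)

/-- One step in contracting an edge loop: move the base point along the loop, or cancel two
consecutive mutually inverse edges. -/
inductive LoopStep : List (E × Bool) → List (E × Bool) → Prop
  | rotate (P Q : List (E × Bool)) : LoopStep (P ++ Q) (Q ++ P)
  | cancel {P Q : List (E × Bool)} (h : FreeGroup.Red.Step P Q) : LoopStep P Q

/-- `Q` is a cyclic reduction of the edge loop `P`. -/
def IsCyclicReduction (P Q : List (E × Bool)) : Prop :=
  Relation.ReflTransGen LoopStep P Q ∧ FreeGroup.IsCyclicallyReduced Q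

/-- The edge `e` belongs to the element `α` of the fundamental group based at `x₀`: every cyclic
reduction of (an edge loop at `x₀` representing) `α` uses `e` or its reverse. -/
def Belongs (G : DirGraph V E) (T : Set E) (x₀ : V) (e : E) (α : Pi T) : Prop :=
  ∀ P Q : List (E × Bool), G.IsPath x₀ x₀ P → word T P = α → IsCyclicReduction P Q →
    ∃ b : Bool, (e, b) ∈ Q

/-- `γ` is an initial subword of `w` (both written as reduced words in the generators). -/
def IsInitialSubword {A : Type*} (γ w : FreeGroup A) : Prop :=
  ∃ L M : List (A × Bool),
    FreeGroup.IsReduced (L ++ M) ∧ FreeGroup.mk L = γ ∧ FreeGroup.mk (L ++ M) = w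

/-- `w₁` and `w₂` are powers (with integer exponents) of a common word. -/
def PowersOfCommonWord {A : Type*} (w₁ w₂ : FreeGroup A) : Prop :=
  ∃ (w : FreeGroup A) (k₁ k₂ : ℤ), w₁ = w ^ k₁ ∧ w₂ = w ^ k₂

end Combinatorics

section Topology

/-- The points of the graph as a topological space: its vertices, and for every edge an open unit
interval of interior points. -/
inductive Space (G : DirGraph V E) : Type _
  | vertex (v : V) : Space G
  | inner (e : E) (t : Set.Ioo (0 : ℝ) 1) : Space G

open Classical in
/-- The parametrization of the closed edge `e` by the unit interval, from the initial to the
terminal vertex. -/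
noncomputable def edgeMap (G : DirGraph V E) (e : E) (t : unitInterval) : G.Space :=
  if h : (t : ℝ) ∈ Set.Ioo (0 : ℝ) 1 then .inner e ⟨t, h⟩
  else if t = 0 then .vertex (G.src e) else .vertex (G.tgt e)

/-- The weak topology: a set is open iff its preimage in every closed edge is open. -/
noncomputable instance (G : DirGraph V E) : TopologicalSpace G.Space :=
  ⨆ e : E, TopologicalSpace.coinduced (G.edgeMap e) inferInstance

/-- A vertex map: a self-map of the graph that permutes the vertices. -/
def IsVertexMap (G : DirGraph V E) (f : G.Space → G.Space) : Prop :=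
  ∃ σ : Equiv.Perm V, ∀ v, f (.vertex v) = .vertex (σ v)

/-- The universal covering graph of `G` with its coherent labeling by the spanning tree `T`.
The vertex `(g, v)` is `g Ṽ`, the edge `(g, e)` is `g Ẽ`, and `Ẽ` runs from the chosen lift of the
initial vertex of `e` to `θ_e` times the chosen lift of its terminal vertex. -/
noncomputable def cover (G : DirGraph V E) (T : Set E) : DirGraph (Pi T × V) (Pi T × E) where
  src d := (d.1, G.src d.2)
  tgt d := (d.1 * theta T d.2, G.tgt d.2)

variable {G : DirGraph V E} {T : Set E}

/-- The covering projection. -/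
def proj : (G.cover T).Space → G.Space
  | .vertex a => .vertex a.2
  | .inner d t => .inner d.2 t

/-- The covering transformation given by `g`. -/
def deck (g : Pi T) : (G.cover T).Space → (G.cover T).Space
  | .vertex a => .vertex (g * a.1, a.2)
  | .inner d t => .inner (g * d.1, d.2) t

/-- The chosen lift `x̃` of a point `x`: the chosen lift of a vertex, and for an interior point of
an edge `e` the point over `x` in the chosen lift `Ẽ`. -/
def lift : G.Space → (G.cover T).Space
  | .vertex v => .vertex (1, v)
  | .inner e t => .inner (1, e) t

/-- `ft` is the lift of `f` obtained from the homotopy `H` from the identity to `f`: it is the end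
of the lifted homotopy that starts at the identity of the universal cover. -/
def IsLiftAlong {f : C(G.Space, G.Space)} (H : (ContinuousMap.id G.Space).Homotopy f)
    (ft : C((G.cover T).Space, (G.cover T).Space)) : Prop :=
  ∃ Ht : (ContinuousMap.id (G.cover T).Space).Homotopy ft,
    ∀ (t : unitInterval) (x : (G.cover T).Space), proj (Ht (t, x)) = H (t, proj x)

/-- `x ∈ Fix(fⁿ)` has rotation element `w^{1/n}` with respect to the lift `ft` of `f`. -/
def HasRotationElement (f : G.Space → G.Space) (ft : (G.cover T).Space → (G.cover T).Space)
    (x : G.Space) (w : Pi T) (n : ℕ) : Prop :=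
  0 < n ∧ f^[n] x = x ∧ ft^[n] (lift x) = deck w (lift x)

end Topology

end DirGraph

/-!
The universal cover of `G` is a tree, and a lift of the edge `e` cuts it into two parts. If the
`q`-th iterate of the lift `ft` maps the two endpoints of the chosen lift `ẽ` of `e` to different
sides of the translate `h ẽ`, then the image of `ẽ` crosses `h ẽ`, and the intermediate value
theorem gives a point `x̃` of `ẽ` that is mapped to `h x̃`, so a periodic point with rotation
element `h^{1/q}` (`exists_eq_edgeMap_of_ahead_ne`, `exists_hasRotationElement`). Since `ft` commutes
with covering transformations (`IsLiftAlong.commute_deck`, by unique path lifting), when `q` is a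
common multiple of `m` and `n` the endpoints of `ẽ` are mapped to their translates by `w₁^(q/m)` and
`w₂^(q/n)`. It remains to see that `h = w₁^p γ₁` separates these two vertices when `p` and
`q/m - p` are large; the claim about `w₂` is symmetric.

As `e` belongs to `w₁`, the axis of `w₁` in the tree runs through a translate of `ẽ`, and after
a shift by a power of `w₁` this translate is `γ₁ ẽ` with `γ₁` an initial subword of `w₁`
(`Belongs.exists_initialSubword`). So `w₁^p γ₁ ẽ` separates the far future of the orbit of a vertex
under `w₁` from its far past. Also, for large `p` it does not separate the base vertex from the
vertices over powers of `w₂` (`eventually_ahead_iff`): the translates of `ẽ` by `h` that do so have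
`h = w₂^i z` with `z` in a finite set, so by the pigeonhole principle infinitely many exceptions
`w₁^p γ₁ = w₂^i z` would give a relation `w₁^a = w₂^b` with `a ≠ 0`, and in a free group such a
relation makes `w₁` and `w₂` powers of a common word (`powersOfCommonWord_of_zpow_eq_zpow`).

The two sides of `ẽ` are described algebraically, by the predicate `Ahead`: the cover is embedded
into the Cayley tree of the free group on all edges of `G` (`pathElt`), where a vertex is ahead of
`ẽ` if its reduced word starts with the letter `e`.
-/

/-! ### Relations between powers in free groups -/

namespace DirGraph

/-- In a free group of rank at least two, no two elements with a nontrivial relation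
`x ^ a = y ^ b` generate: their images in a rank two quotient `ℤ²` would be linearly dependent. -/
theorem subsingleton_of_closure_pair_eq_top {X : Type*} (x y : FreeGroup X)
    (htop : Subgroup.closure {x, y} = ⊤) {a b : ℤ} (ha : a ≠ 0) (hab : x ^ a = y ^ b) :
    Subsingleton X := by
  classical
  refine ⟨fun i j ↦ ?_⟩
  by_contra hij
  -- The exponent sums of the letters `i` and `j`.
  let s (k : X) : FreeGroup X →* Multiplicative ℤ :=
    FreeGroup.lift fun l ↦ Multiplicative.ofAdd (if l = k then 1 else 0)
  let c (k : X) (z : FreeGroup X) : ℤ := (s k z).toAdd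
  have hgen (k : X) : ∃ α β : ℤ, ∀ l, (if k = l then 1 else 0) = α * c l x + β * c l y := by
    have hmem : FreeGroup.of k ∈ Subgroup.closure {x, y} := htop ▸ Subgroup.mem_top _
    have : ∀ z ∈ Subgroup.closure {x, y}, ∃ α β : ℤ, ∀ l, c l z = α * c l x + β * c l y := by
      intro z hz
      induction hz using Subgroup.closure_induction with
      | mem z hz =>
        rcases hz with rfl | rfl
        · exact ⟨1, 0, by simp⟩
        · exact ⟨0, 1, by simp⟩
      | one => exact ⟨0, 0, by simp [c]⟩
      | mul z z' _ _ h h' =>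
        obtain ⟨α, β, h⟩ := h
        obtain ⟨α', β', h'⟩ := h'
        refine ⟨α + α', β + β', fun l ↦ ?_⟩
        have : c l (z * z') = c l z + c l z' := by simp [c]
        rw [this, h, h']; ring
      | inv z _ h =>
        obtain ⟨α, β, h⟩ := h
        refine ⟨-α, -β, fun l ↦ ?_⟩
        have : c l z⁻¹ = - c l z := by simp [c]
        rw [this, h]; ring
    obtain ⟨α, β, h⟩ := this _ hmem
    exact ⟨α, β, fun l ↦ by rw [← h l]; simp [c, s]⟩
  have hrel (k : X) : a * c k x = b * c k y := by
    have := congrArg (c k) hab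
    simpa [c] using this
  obtain ⟨α, β, h⟩ := hgen i
  obtain ⟨γ, δ, h'⟩ := hgen j
  have h1 := h i
  have h2 := h j
  have h3 := h' i
  have h4 := h' j
  simp only [if_neg hij, if_neg (Ne.symm hij), if_true] at h1 h2 h3 h4
  have hdet : a * (c i x * c j y - c j x * c i y) = 0 := by
    linear_combination c j y * hrel i - c i y * hrel j
  have hdet' : c i x * c j y - c j x * c i y = 0 := by
    rcases mul_eq_zero.1 hdet with h | h
    · exact absurd h ha
    · exact h
  have : (1 : ℤ) = (α * δ - β * γ) * (c i x * c j y - c j x * c i y) := by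
    have e1 : (1 : ℤ) = (α * c i x + β * c i y) * (γ * c j x + δ * c j y) -
      (α * c j x + β * c j y) * (γ * c i x + δ * c i y) := by
      rw [← h1, ← h2, ← h3, ← h4]; norm_num
    rw [e1]; ring
  rw [hdet'] at this
  simp at this

/-- In a free group, two elements with a nontrivial relation `x ^ a = y ^ b` are powers of a
common element: by the Nielsen–Schreier theorem they generate a free group, and it is cyclic. -/
theorem powersOfCommonWord_of_zpow_eq_zpow {A : Type*} (x y : FreeGroup A) {a b : ℤ}
    (ha : a ≠ 0) (hab : x ^ a = y ^ b) : PowersOfCommonWord x y := by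
  let H : Subgroup (FreeGroup A) := Subgroup.closure {x, y}
  have hx : x ∈ H := Subgroup.subset_closure (by simp)
  have hy : y ∈ H := Subgroup.subset_closure (by simp)
  let φ : H ≃* FreeGroup (IsFreeGroup.Generators H) := IsFreeGroup.toFreeGroup H
  have hφ : Subgroup.closure {φ ⟨x, hx⟩, φ ⟨y, hy⟩} = ⊤ := by
    have h1 : Subgroup.closure ({⟨x, hx⟩, ⟨y, hy⟩} : Set H) = ⊤ := by
      rw [← Subgroup.closure_closure_coe_preimage (k := {x, y})]
      congr 1
      ext ⟨z, hz⟩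
      simp
    have h2 := congrArg (Subgroup.map φ.toMonoidHom) h1
    rw [MonoidHom.map_closure, ← MonoidHom.range_eq_map] at h2
    rw [MonoidHom.range_eq_top.2 φ.surjective] at h2
    simpa [Set.image_pair] using h2
  have hsub : Subsingleton (IsFreeGroup.Generators H) := by
    refine subsingleton_of_closure_pair_eq_top _ _ hφ ha (b := b) ?_
    rw [← map_zpow, ← map_zpow]
    congr 1
    exact Subtype.ext (by simpa using hab)
  have hcyc : IsCyclic (FreeGroup (IsFreeGroup.Generators H)) := by
    rcases isEmpty_or_nonempty (IsFreeGroup.Generators H) with h | h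
    · infer_instance
    · have := uniqueOfSubsingleton h.some
      infer_instance
  obtain ⟨g, hg⟩ := hcyc.exists_generator
  obtain ⟨k₁, hk₁⟩ := Subgroup.mem_zpowers_iff.1 (hg (φ ⟨x, hx⟩))
  obtain ⟨k₂, hk₂⟩ := Subgroup.mem_zpowers_iff.1 (hg (φ ⟨y, hy⟩))
  refine ⟨(φ.symm g : H), k₁, k₂, ?_, ?_⟩
  · rw [← Subgroup.coe_zpow, ← map_zpow, hk₁]; simp
  · rw [← Subgroup.coe_zpow, ← map_zpow, hk₂]; simp

end DirGraph

namespace DirGraph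

variable {V E : Type*} {G : DirGraph V E} {T : Set E}

/-! ### Edge paths and their words -/

theorem isPath_append {u v : V} {P Q : List (E × Bool)} :
    G.IsPath u v (P ++ Q) ↔ ∃ z, G.IsPath u z P ∧ G.IsPath z v Q := by
  induction P generalizing u with
  | nil => simp [IsPath]
  | cons d P ih => simp [IsPath, ih, and_assoc]

theorem isPath_singleton {u v : V} {d : E × Bool} :
    G.IsPath u v [d] ↔ G.first d = u ∧ G.last d = v := Iff.rfl

theorem first_not (d : E) (b : Bool) : G.first (d, !b) = G.last (d, b) := by
  cases b <;> rfl

theorem last_not (d : E) (b : Bool) : G.last (d, !b) = G.first (d, b) := by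
  cases b <;> rfl

theorem IsPath.invRev {u v : V} {P : List (E × Bool)} (h : G.IsPath u v P) :
    G.IsPath v u (FreeGroup.invRev P) := by
  induction P generalizing u with
  | nil => exact Eq.symm h
  | cons d P ih =>
    obtain ⟨h1, h2⟩ := h
    rw [FreeGroup.invRev_cons]
    refine isPath_append.2 ⟨_, ih h2, ?_⟩
    simp only [FreeGroup.invRev, List.map_cons, List.map_nil, List.reverse_cons, List.reverse_nil,
      List.nil_append, IsPath]
    exact ⟨first_not _ _, (last_not _ _).trans h1⟩

theorem IsPath.redStep {u v : V} {P Q : List (E × Bool)} (h : G.IsPath u v P)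
    (hs : FreeGroup.Red.Step P Q) : G.IsPath u v Q := by
  cases hs with
  | @not L₁ L₂ x b =>
    obtain ⟨z, h1, h2, h3, h4⟩ := isPath_append.1 h
    rw [last_not, h2] at h4
    exact isPath_append.2 ⟨z, h1, h4⟩

theorem IsPath.red {u v : V} {P Q : List (E × Bool)} (h : G.IsPath u v P)
    (hs : FreeGroup.Red P Q) : G.IsPath u v Q := by
  induction hs with
  | refl => exact h
  | tail _ hs ih => exact ih.redStep hs

theorem word_append (P Q : List (E × Bool)) : word T (P ++ Q) = word T P * word T Q := by
  simp [word, ← FreeGroup.mul_mk]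

theorem word_cons (d : E × Bool) (P : List (E × Bool)) :
    word T (d :: P) = word T [d] * word T P := word_append [d] P

theorem word_nil : word T ([] : List (E × Bool)) = 1 := rfl

theorem word_invRev (P : List (E × Bool)) : word T (FreeGroup.invRev P) = (word T P)⁻¹ := by
  simp [word, ← FreeGroup.inv_mk]

theorem word_singleton_true (d : E) : word T [(d, true)] = theta T d := by simp [word]

theorem word_singleton_false (d : E) : word T [(d, false)] = (theta T d)⁻¹ := by simp [word]

theorem theta_of_mem {d : E} (h : d ∈ T) : theta T d = 1 := by simp [theta, h]

theorem theta_of_notMem {d : E} (h : d ∉ T) : theta T d = FreeGroup.of ⟨d, h⟩ := by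
  simp [theta, h]

theorem word_eq_one {P : List (E × Bool)} (h : ∀ d ∈ P, d.1 ∈ T) : word T P = 1 := by
  induction P with
  | nil => rfl
  | cons d P ih =>
    rw [word_cons, ih fun d hd ↦ h d (List.mem_cons_of_mem _ hd)]
    have := theta_of_mem (h d List.mem_cons_self)
    obtain ⟨d, _ | _⟩ := d
    · simp_all [word_singleton_false]
    · simp_all [word_singleton_true]

/-! ### The cover inside the Cayley tree of the free group on all edges -/

/-- The class in the free group on all edges of the path in the spanning tree from `u` to `v`. -/
noncomputable def treeElt (hT : G.IsSpanningTree T) (u v : V) : FreeGroup E :=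
  FreeGroup.mk (hT u v).choose

/-- Any path inside the tree computes the tree element: its reduction is the reduced tree path. -/
theorem treeElt_eq (hT : G.IsSpanningTree T) {u v : V} {P : List (E × Bool)}
    (hP : G.IsPath u v P) (hPT : ∀ d ∈ P, d.1 ∈ T) : treeElt hT u v = FreeGroup.mk P := by
  classical
  rw [← FreeGroup.reduce.self (L := P), treeElt]
  congr 1
  refine ((hT u v).choose_spec.2 _ ⟨hP.red FreeGroup.reduce.red, ?_, fun d hd ↦ ?_⟩).symm
  · exact FreeGroup.isReduced_iff_reduce_eq.2 FreeGroup.reduce.idem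
  · exact hPT d ((FreeGroup.Red.sublist FreeGroup.reduce.red).subset hd)

theorem exists_treePath (hT : G.IsSpanningTree T) (u v : V) :
    ∃ P, G.IsPath u v P ∧ (∀ d ∈ P, d.1 ∈ T) ∧ treeElt hT u v = FreeGroup.mk P :=
  ⟨_, (hT u v).choose_spec.1.1, (hT u v).choose_spec.1.2.2, rfl⟩

theorem treeElt_self (hT : G.IsSpanningTree T) (u : V) : treeElt hT u u = 1 :=
  treeElt_eq hT (P := []) rfl (by simp)

theorem treeElt_mul_of (hT : G.IsSpanningTree T) (u : V) {d : E} (hd : d ∈ T) :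
    treeElt hT u (G.src d) * FreeGroup.of d = treeElt hT u (G.tgt d) := by
  obtain ⟨P, h1, h2, h3⟩ := exists_treePath hT u (G.src d)
  rw [h3, FreeGroup.of, FreeGroup.mul_mk]
  refine (treeElt_eq hT (isPath_append.2 ⟨_, h1, isPath_singleton.2 ⟨rfl, rfl⟩⟩)
    fun d' hd' ↦ ?_).symm
  rcases List.mem_append.1 hd' with h | h
  · exact h2 d' h
  · simp_all

/-- The universal cover embeds as a subtree into the Cayley tree of the free group on all edges:
the vertex `(g, v)` is sent to the class of the edge paths of `G` that start at `u` and lift to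
paths in the cover from `(1, u)` to `(g, v)`. -/
noncomputable def pathElt (hT : G.IsSpanningTree T) (u : V) (g : Pi T) (v : V) : FreeGroup E :=
  FreeGroup.lift (fun d : {e : E // e ∉ T} ↦
    treeElt hT u (G.src d) * FreeGroup.of d.1 * (treeElt hT u (G.tgt d))⁻¹) g * treeElt hT u v

theorem pathElt_one_self (hT : G.IsSpanningTree T) (u : V) : pathElt hT u 1 u = 1 := by
  simp [pathElt, treeElt_self]

theorem pathElt_mul_theta (hT : G.IsSpanningTree T) (u : V) (g : Pi T) (d : E) :
    pathElt hT u (g * theta T d) (G.tgt d) = pathElt hT u g (G.src d) * FreeGroup.of d := by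
  by_cases hd : d ∈ T
  · simp [pathElt, theta_of_mem hd, mul_assoc, treeElt_mul_of hT u hd]
  · simp [pathElt, theta_of_notMem hd, mul_assoc]

theorem pathElt_mul_word (hT : G.IsSpanningTree T) (u : V) (g : Pi T) {v v' : V}
    {P : List (E × Bool)} (hP : G.IsPath v v' P) :
    pathElt hT u (g * word T P) v' = pathElt hT u g v * FreeGroup.mk P := by
  induction P generalizing g v with
  | nil =>
    obtain rfl : v = v' := hP
    simp [word_nil, ← FreeGroup.one_eq_mk]
  | cons d P ih =>
    obtain ⟨rfl, h⟩ := hP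
    have hmk : FreeGroup.mk (d :: P) = FreeGroup.mk [d] * FreeGroup.mk P := by
      rw [FreeGroup.mul_mk, List.singleton_append]
    rw [word_cons, ← mul_assoc, ih _ h, hmk, ← mul_assoc]
    congr 1
    obtain ⟨d, _ | _⟩ := d
    · rw [word_singleton_false]
      have := pathElt_mul_theta hT u (g * (theta T d)⁻¹) d
      rw [inv_mul_cancel_right] at this
      change _ = pathElt hT u g (G.tgt d) * _
      rw [this, mul_assoc, FreeGroup.of, FreeGroup.mul_mk]
      have h1 : FreeGroup.mk ([(d, true)] ++ [(d, false)]) = 1 := by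
        rw [← FreeGroup.mul_mk]
        exact mul_inv_cancel (FreeGroup.of d)
      rw [h1, mul_one]; rfl
    · rw [word_singleton_true]
      exact pathElt_mul_theta hT u g d

/-- Reading off the labels recovers the sheet of a vertex, so that `pathElt` separates sheets. -/
theorem lift_theta_pathElt (hT : G.IsSpanningTree T) (u : V) (g : Pi T) (v : V) :
    FreeGroup.lift (theta T) (pathElt hT u g v) = g := by
  have htree (v : V) : FreeGroup.lift (theta T) (treeElt hT u v) = 1 := by
    obtain ⟨P, -, h2, h3⟩ := exists_treePath hT u v
    rw [h3]
    exact word_eq_one h2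
  rw [pathElt, map_mul, htree, mul_one, ← MonoidHom.comp_apply]
  conv_rhs => rw [← MonoidHom.id_apply (FreeGroup _) g]
  congr 1
  ext d
  simp [htree, theta_of_notMem d.2]

/-! ### The two sides of a lifted edge -/

/-- In the Cayley tree of a free group, the edge from `1` to `a` is the only one that joins an
element whose reduced word starts with `a` to one whose reduced word does not. -/
theorem head?_toWord_mul_of {A : Type*} [DecidableEq A] {a d : A} {y : FreeGroup A}
    (h : ¬ (y = 1 ∧ d = a)) :
    (y * FreeGroup.of d).toWord.head? = some (a, true) ↔ y.toWord.head? = some (a, true) := by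
  have hy : FreeGroup.IsReduced y.toWord := FreeGroup.isReduced_toWord
  rcases List.eq_nil_or_concat y.toWord with h0 | ⟨L, ⟨c, b⟩, hL⟩
  · have hy1 : y = 1 := FreeGroup.toWord_eq_nil_iff.1 h0
    subst hy1
    simpa using h
  · rw [List.concat_eq_append] at hL
    have hmk : y = FreeGroup.mk (L ++ [(c, b)]) := by rw [← hL, FreeGroup.mk_toWord]
    rw [hL] at hy
    by_cases hc : c = d ∧ b = false
    · obtain ⟨rfl, rfl⟩ := hc
      have h1 : y * FreeGroup.of c = FreeGroup.mk L := by
        rw [hmk, ← FreeGroup.mul_mk, mul_assoc]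
        have : FreeGroup.mk [(c, false)] * FreeGroup.of c = 1 := inv_mul_cancel (FreeGroup.of c)
        rw [this, mul_one]
      rw [h1, FreeGroup.toWord_mk,
        (hy.infix (List.prefix_append L _).isInfix).reduce_eq, hL]
      cases L <;> simp
    · have h1 : y * FreeGroup.of d = FreeGroup.mk (L ++ [(c, b)] ++ [(d, true)]) := by
        rw [hmk, FreeGroup.of, FreeGroup.mul_mk]
      have h2 : FreeGroup.IsReduced (L ++ [(c, b)] ++ [(d, true)]) := by
        refine List.isChain_append.2 ⟨hy, List.isChain_singleton _, ?_⟩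
        simp only [List.getLast?_concat, Option.mem_def, Option.some.injEq, List.head?_cons]
        rintro _ rfl _ rfl hcd
        cases b <;> simp_all
      rw [h1, FreeGroup.toWord_mk, h2.reduce_eq, hL]
      cases L <;> simp

open Classical in
/-- The chosen lift of the edge `e` cuts the universal cover into two parts. `Ahead hT e g v` says
that the vertex `(g, v)` lies in the part of the terminal vertex of the edge, that is, that the
reduced edge path from the initial vertex to `(g, v)` starts by crossing the edge. -/
def Ahead (hT : G.IsSpanningTree T) (e : E) (g : Pi T) (v : V) : Prop :=
  (pathElt hT (G.src e) g v).toWord.head? = some (e, true)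

variable (hT : G.IsSpanningTree T) (e : E)

theorem not_ahead_src : ¬ Ahead hT e 1 (G.src e) := by
  simp [Ahead, pathElt_one_self]

theorem ahead_tgt : Ahead hT e (theta T e) (G.tgt e) := by
  have := pathElt_mul_theta hT (G.src e) 1 e
  rw [one_mul, pathElt_one_self, one_mul] at this
  simp [Ahead, this]

/-- The chosen lift of `e` is the only edge of the cover that joins its two sides. -/
theorem ahead_edge {g : Pi T} {d : E} (h : ¬ (g = 1 ∧ d = e)) :
    Ahead hT e (g * theta T d) (G.tgt d) ↔ Ahead hT e g (G.src d) := by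
  classical
  rw [Ahead, Ahead, pathElt_mul_theta]
  convert head?_toWord_mul_of (a := e) (d := d) (y := pathElt hT (G.src e) g (G.src d)) ?_
  rintro ⟨h1, rfl⟩
  refine h ⟨?_, rfl⟩
  rw [← lift_theta_pathElt hT (G.src d) g (G.src d), h1, map_one]

/-- Away from the sheet of the edge, each sheet lies entirely on one side of it. -/
theorem ahead_congr {g : Pi T} (hg : g ≠ 1) (v v' : V) : Ahead hT e g v ↔ Ahead hT e g v' := by
  obtain ⟨P, h1, h2, -⟩ := exists_treePath hT v v'
  induction P generalizing v with
  | nil => obtain rfl : v = v' := h1; rfl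
  | cons d P ih =>
    obtain ⟨rfl, h⟩ := h1
    rw [← ih _ h fun d hd ↦ h2 d (List.mem_cons_of_mem _ hd)]
    have hd := theta_of_mem (h2 d List.mem_cons_self)
    have := ahead_edge hT e (g := g) (d := d.1) (by simp [hg])
    rw [hd, mul_one] at this
    obtain ⟨d, _ | _⟩ := d
    · exact this
    · exact this.symm

theorem ahead_mul_letter {y : Pi T} {d : {e : E // e ∉ T} × Bool} (hy : y ≠ 1)
    (hyd : y * FreeGroup.mk [d] ≠ 1) (v v' : V) :
    Ahead hT e y v ↔ Ahead hT e (y * FreeGroup.mk [d]) v' := by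
  obtain ⟨d, _ | _⟩ := d
  · have h1 : y = y * FreeGroup.mk [(d, false)] * theta T d.1 := by
      have : FreeGroup.mk [(d, false)] = (FreeGroup.of d)⁻¹ := rfl
      rw [theta_of_notMem d.2, this, inv_mul_cancel_right]
    have := ahead_edge hT e (g := y * FreeGroup.mk [(d, false)]) (d := d) (by simp [hyd])
    rw [← h1] at this
    rw [ahead_congr hT e hy v (G.tgt d), this, ahead_congr hT e hyd]
  · have := ahead_edge hT e (g := y) (d := d) (by simp [hy])
    rw [theta_of_notMem d.2] at this
    rw [ahead_congr hT e hyd v' (G.tgt d), ahead_congr hT e hy v (G.src d)]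
    exact this.symm

/-- The form of `isInitialSubword_of_ahead_ne` that allows induction: the list need not be
reduced. -/
theorem exists_eq_append_of_ahead_ne (L : List ({e : E // e ∉ T} × Bool)) (h : Pi T) (v : V)
    (hne : ¬ (Ahead hT e h⁻¹ v ↔ Ahead hT e (h⁻¹ * FreeGroup.mk L) v)) :
    ∃ L₁ L₂, L = L₁ ++ L₂ ∧ h = FreeGroup.mk L₁ := by
  induction L generalizing h with
  | nil => simp [← FreeGroup.one_eq_mk] at hne
  | cons d L ih =>
    by_cases h1 : h = 1
    · exact ⟨[], d :: L, rfl, h1⟩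
    by_cases h2 : h = FreeGroup.mk [d]
    · exact ⟨[d], L, rfl, h2⟩
    have h3 := ahead_mul_letter hT e (d := d) (inv_ne_one.2 h1)
      (fun h4 ↦ h2 (inv_mul_eq_one.1 h4)) v v
    have h5 : h⁻¹ * FreeGroup.mk (d :: L) =
        ((FreeGroup.mk [d])⁻¹ * h)⁻¹ * FreeGroup.mk L := by
      rw [← List.singleton_append, ← FreeGroup.mul_mk]; group
    have h6 : h⁻¹ * FreeGroup.mk [d] = ((FreeGroup.mk [d])⁻¹ * h)⁻¹ := by group
    rw [h3, h5, h6] at hne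
    obtain ⟨L₁, L₂, rfl, h7⟩ := ih _ hne
    refine ⟨d :: L₁, L₂, rfl, ?_⟩
    rw [← List.singleton_append, ← FreeGroup.mul_mk, ← h7]; group

/-- If the translate by `h` of the lift of `e` separates `(1, v)` from `(w, v)`, then `h` is an
initial subword of `w`: the reduced path between them runs through the sheets of the initial
subwords of `w`. -/
theorem isInitialSubword_of_ahead_ne (h w : Pi T) (v : V)
    (hne : ¬ (Ahead hT e h⁻¹ v ↔ Ahead hT e (h⁻¹ * w) v)) : IsInitialSubword h w := by
  classical
  rw [← FreeGroup.mk_toWord (x := w)] at hne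
  obtain ⟨L₁, L₂, h1, h2⟩ := exists_eq_append_of_ahead_ne hT e _ h v hne
  exact ⟨L₁, L₂, h1 ▸ FreeGroup.isReduced_toWord, h2.symm, by rw [← h1, FreeGroup.mk_toWord]⟩

theorem finite_setOf_isInitialSubword {A : Type*} (w : FreeGroup A) :
    {h | IsInitialSubword h w}.Finite := by
  classical
  refine ((List.finite_toSet w.toWord.inits).image FreeGroup.mk).subset ?_
  rintro _ ⟨L, M, hr, rfl, rfl⟩
  exact ⟨L, by simp [hr.reduce_eq], rfl⟩

end DirGraph

namespace DirGraph

open Filter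

variable {V E : Type*} {G : DirGraph V E} {T : Set E}

/-! ### Cyclic reductions and the axis of an element -/

theorem exists_isPath_word (hT : G.IsSpanningTree T) (g : Pi T) (u v : V) :
    ∃ P, G.IsPath u v P ∧ word T P = g := by
  induction g using FreeGroup.induction_on generalizing u v with
  | C1 =>
    obtain ⟨P, h1, h2, -⟩ := exists_treePath hT u v
    exact ⟨P, h1, word_eq_one h2⟩
  | of d =>
    obtain ⟨P, h1, h2, -⟩ := exists_treePath hT u (G.src d)
    obtain ⟨Q, h3, h4, -⟩ := exists_treePath hT (G.tgt d) v
    refine ⟨P ++ (d.1, true) :: Q, isPath_append.2 ⟨_, h1, rfl, h3⟩, ?_⟩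
    rw [word_append, word_cons, word_eq_one h2, word_eq_one h4, word_singleton_true,
      theta_of_notMem d.2]
    simp
  | inv_of d h =>
    obtain ⟨P, h1, h2⟩ := h v u
    exact ⟨FreeGroup.invRev P, h1.invRev, by rw [word_invRev, h2]⟩
  | mul x y hx hy =>
    obtain ⟨P, h1, h2⟩ := hx u v
    obtain ⟨Q, h3, h4⟩ := hy v v
    exact ⟨P ++ Q, isPath_append.2 ⟨_, h1, h3⟩, by rw [word_append, h2, h4]⟩

theorem LoopStep.exists_isPath {P Q : List (E × Bool)} (h : LoopStep P Q)
    (hP : ∃ u, G.IsPath u u P) : ∃ u, G.IsPath u u Q := by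
  obtain ⟨u, hu⟩ := hP
  cases h with
  | rotate P Q =>
    obtain ⟨z, h1, h2⟩ := isPath_append.1 hu
    exact ⟨z, isPath_append.2 ⟨u, h2, h1⟩⟩
  | cancel h => exact ⟨u, hu.redStep h⟩

theorem LoopStep.isConj {P Q : List (E × Bool)} (h : LoopStep P Q) :
    IsConj (word T P) (word T Q) := by
  cases h with
  | rotate P Q =>
    rw [word_append, word_append, isConj_iff]
    exact ⟨(word T P)⁻¹, by group⟩
  | cancel h =>
    have : FreeGroup.mk P = FreeGroup.mk Q := Quot.sound h
    rw [word, word, this]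

theorem reflTransGen_loopStep_of_red {P Q : List (E × Bool)} (h : FreeGroup.Red P Q) :
    Relation.ReflTransGen LoopStep P Q := by
  induction h with
  | refl => exact .refl
  | tail _ h ih => exact ih.tail (.cancel h)

/-- Every loop contracts to the cyclically reduced core of its reduced word: after reducing, a rotation
brings the conjugator next to its inverse. -/
theorem exists_isCyclicReduction (P : List (E × Bool)) : ∃ Q, IsCyclicReduction P Q := by
  classical
  let R := FreeGroup.reduce P
  let C := FreeGroup.reduceCyclically.conjugator R
  refine ⟨FreeGroup.reduceCyclically R, ?_, ?_⟩
  · refine (reflTransGen_loopStep_of_red (Q := R) FreeGroup.reduce.red).trans ?_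
    have h1 : C ++ FreeGroup.reduceCyclically R ++ FreeGroup.invRev C = R :=
      FreeGroup.reduceCyclically.conj_conjugator_reduceCyclically R
    have h2 : LoopStep R (FreeGroup.reduceCyclically R ++ (FreeGroup.invRev C ++ C)) := by
      rw [← List.append_assoc]
      conv_lhs => rw [← h1, List.append_assoc]
      exact .rotate _ _
    refine .trans (.single h2) (reflTransGen_loopStep_of_red ?_)
    have h3 : FreeGroup.Red (FreeGroup.invRev C ++ C) [] := by
      rw [← FreeGroup.reduce_invRev_left_cancel (L := C)]
      exact FreeGroup.reduce.red
    simpa using (FreeGroup.Red.append_append (FreeGroup.Red.refl (L := _)) h3)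
  · exact FreeGroup.reduceCyclically.isCyclicallyReduced
      (FreeGroup.isReduced_iff_reduce_eq.2 FreeGroup.reduce.idem)

theorem isCyclicallyReduced_rotate {A : Type*} {L M : List (A × Bool)}
    (h : FreeGroup.IsCyclicallyReduced (L ++ M)) : FreeGroup.IsCyclicallyReduced (M ++ L) := by
  rcases eq_or_ne L [] with rfl | hL
  · simpa using h
  rcases eq_or_ne M [] with rfl | hM
  · simpa using h
  obtain ⟨h1, h2⟩ := h
  obtain ⟨h3, h4, h5⟩ := List.isChain_append.1 h1
  rw [List.getLast?_append_of_ne_nil _ hM, List.head?_append_of_ne_nil _ hL] at h2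
  refine ⟨List.isChain_append.2 ⟨h4, h3, h2⟩, ?_⟩
  rw [List.getLast?_append_of_ne_nil _ hL, List.head?_append_of_ne_nil _ hM]
  exact h5

theorem isCyclicallyReduced_invRev {A : Type*} {L : List (A × Bool)}
    (h : FreeGroup.IsCyclicallyReduced L) :
    FreeGroup.IsCyclicallyReduced (FreeGroup.invRev L) := by
  classical
  obtain ⟨h1, h2⟩ := h
  refine ⟨?_, ?_⟩
  · rw [FreeGroup.isReduced_iff_reduce_eq, FreeGroup.reduce_invRev, h1.reduce_eq]
  · simp only [FreeGroup.invRev, List.getLast?_reverse, List.head?_reverse, List.head?_map,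
      List.getLast?_map, Option.mem_def, Option.map_eq_some_iff]
    rintro _ ⟨a, ha, rfl⟩ _ ⟨b, hb, rfl⟩ hab
    simpa using (h2 b hb a ha hab.symm).symm

/-- An element to which `e` belongs is, up to inversion, conjugate to a cyclically reduced loop
that starts by crossing `e`. -/
theorem Belongs.exists_loop {e : E} {x₀ : V} {w : Pi T} (hT : G.IsSpanningTree T)
    (h : G.Belongs T x₀ e w) : ∃ R : List (E × Bool),
      G.IsPath (G.src e) (G.src e) ((e, true) :: R) ∧
      FreeGroup.IsCyclicallyReduced ((e, true) :: R) ∧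
      (IsConj (word T ((e, true) :: R)) w ∨ IsConj (word T ((e, true) :: R)) w⁻¹) := by
  obtain ⟨P, hP, rfl⟩ := exists_isPath_word hT w x₀ x₀
  obtain ⟨Q, hQ⟩ := exists_isCyclicReduction P
  obtain ⟨b, hb⟩ := h P Q hP rfl hQ
  obtain ⟨hPQ, hQc⟩ := hQ
  have hQ' : (∃ u, G.IsPath u u Q) ∧ IsConj (word T P) (word T Q) := by
    clear hb hQc
    induction hPQ with
    | refl => exact ⟨⟨x₀, hP⟩, IsConj.refl _⟩
    | tail _ h ih => exact ⟨h.exists_isPath ih.1, ih.2.trans h.isConj⟩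
  obtain ⟨⟨u, hu⟩, hconj⟩ := hQ'
  obtain ⟨L, M, rfl⟩ := List.append_of_mem hb
  have hrot := isCyclicallyReduced_rotate hQc
  obtain ⟨z, h1, h2⟩ := isPath_append.1 hu
  have hz : G.first (e, b) = z := h2.1
  have hloop := isPath_append.2 ⟨u, h2, h1⟩
  have hconj' := (hconj.trans (LoopStep.rotate L ((e, b) :: M)).isConj).symm
  subst hz
  rw [List.cons_append] at hrot hloop hconj'
  cases b with
  | true => exact ⟨M ++ L, hloop, hrot, .inl hconj'⟩
  | false =>
    refine ⟨FreeGroup.invRev (M ++ L), ?_, ?_, .inr ?_⟩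
    · exact ⟨rfl, hloop.2.invRev⟩
    · have := isCyclicallyReduced_invRev hrot
      rw [FreeGroup.invRev_cons] at this
      exact isCyclicallyReduced_rotate this
    · rw [isConj_iff] at hconj' ⊢
      obtain ⟨c, hc⟩ := hconj'
      refine ⟨c * (theta T e)⁻¹, ?_⟩
      rw [← hc, word_cons, word_cons (e, false), word_invRev, word_singleton_true,
        word_singleton_false]
      group

/-- The powers of a cyclically reduced loop starting with `e` are reduced paths in the cover along
an axis through the lift of `e`. -/
theorem ahead_word_zpow (hT : G.IsSpanningTree T) {e : E} {R : List (E × Bool)}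
    (hR : G.IsPath (G.src e) (G.src e) ((e, true) :: R))
    (hc : FreeGroup.IsCyclicallyReduced ((e, true) :: R)) (n : ℤ) :
    Ahead hT e (word T ((e, true) :: R) ^ n) (G.src e) ↔ 0 < n := by
  classical
  set Q := (e, true) :: R with hQ
  have hpath (k : ℕ) : G.IsPath (G.src e) (G.src e) (List.replicate k Q).flatten ∧
      word T (List.replicate k Q).flatten = word T Q ^ k := by
    induction k with
    | zero => exact ⟨rfl, rfl⟩
    | succ k ih =>
      rw [List.replicate_succ, List.flatten_cons, pow_succ', word_append, ih.2]
      exact ⟨isPath_append.2 ⟨_, hR, ih.1⟩, rfl⟩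
  have hred (k : ℕ) := hc.flatten_replicate k
  obtain ⟨k, rfl | rfl⟩ := n.eq_nat_or_neg
  · have h1 := pathElt_mul_word hT (G.src e) 1 (hpath k).1
    rw [(hpath k).2, one_mul, pathElt_one_self, one_mul] at h1
    rw [zpow_natCast, Ahead, h1, FreeGroup.toWord_mk, (hred k).isReduced.reduce_eq]
    cases k with
    | zero => simp
    | succ k => simp [List.replicate_succ, hQ]
  · have h1 := pathElt_mul_word hT (G.src e) (word T Q ^ k)⁻¹ (hpath k).1
    rw [(hpath k).2, inv_mul_cancel, pathElt_one_self] at h1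
    rw [zpow_neg, zpow_natCast, Ahead, eq_inv_of_mul_eq_one_left h1.symm, FreeGroup.inv_mk,
      FreeGroup.toWord_mk, FreeGroup.reduce_invRev, (hred k).isReduced.reduce_eq]
    have h2 : ¬ (0 : ℤ) < -(k : ℤ) := by omega
    simp only [h2, iff_false]
    cases k with
    | zero => simp [FreeGroup.invRev]
    | succ k =>
      intro h3
      simp only [FreeGroup.invRev, List.head?_reverse, List.getLast?_map,
        Option.map_eq_some_iff] at h3
      obtain ⟨a, ha, hae⟩ := h3
      have h4 := (hred (k + 1)).2 a ha (e, true) (by simp [List.replicate_succ, hQ])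
      obtain ⟨a1, a2⟩ := a
      simp only [Prod.mk.injEq, Bool.not_eq_eq_eq_not, Bool.not_true] at hae
      simp [hae.1, hae.2] at h4

theorem zpow_injective {A : Type*} {w : FreeGroup A} (hw : w ≠ 1) :
    Function.Injective fun n : ℤ ↦ w ^ n :=
  injective_zpow_iff_not_isOfFinOrder.2 (not_isOfFinOrder_of_isMulTorsionFree hw)

/-- If `e` belongs to `w`, then the axis of `w` in the universal cover runs through a translate of
the lift of `e` by an initial subword `γ` of `w`: the orbit of a vertex under `w` stays on opposite
sides of this translate in the far future and in the far past. -/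
theorem Belongs.exists_initialSubword {e : E} {x₀ : V} {w : Pi T} (hT : G.IsSpanningTree T)
    (h : G.Belongs T x₀ e w) : ∃ γ : Pi T, IsInitialSubword γ w ∧ ∃ a : Prop,
      (∀ᶠ n : ℤ in atTop, (Ahead hT e (γ⁻¹ * w ^ n) (G.src e) ↔ a)) ∧
      (∀ᶠ n : ℤ in atBot, (Ahead hT e (γ⁻¹ * w ^ n) (G.src e) ↔ ¬ a)) := by
  obtain ⟨R, hR, hc, hconj⟩ := h.exists_loop hT
  set v := word T ((e, true) :: R) with hv
  have hside := ahead_word_zpow hT hR hc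
  rw [← hv] at hside
  have hv1 : v ≠ 1 := by
    intro h1
    have h2 := (hside 1).2 one_pos
    rw [h1, one_zpow] at h2
    exact not_ahead_src hT e h2
  -- Right translation by `k⁻¹` moves only finitely many points of the orbit across the edge.
  have hfin (k : Pi T) : ∀ᶠ n : ℤ in cofinite,
      (Ahead hT e (v ^ n * k⁻¹) (G.src e) ↔ 0 < n) := by
    have h1 : {n : ℤ | IsInitialSubword (v ^ (-n)) k⁻¹}.Finite :=
      Set.Finite.preimage (f := fun n : ℤ ↦ v ^ (-n))
        ((zpow_injective hv1).comp neg_injective).injOn (finite_setOf_isInitialSubword k⁻¹)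
    filter_upwards [h1.compl_mem_cofinite] with n hn
    by_contra h2
    refine hn (isInitialSubword_of_ahead_ne hT e _ _ (G.src e) ?_)
    rw [zpow_neg, inv_inv, hside]
    tauto
  have key : ∃ (k : Pi T) (a : Prop),
      (∀ᶠ n : ℤ in atTop, (Ahead hT e (k⁻¹ * w ^ n) (G.src e) ↔ a)) ∧
      (∀ᶠ n : ℤ in atBot, (Ahead hT e (k⁻¹ * w ^ n) (G.src e) ↔ ¬ a)) := by
    rcases hconj with hconj | hconj
    · obtain ⟨k, hk⟩ := isConj_iff.1 hconj
      have h1 := hfin k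
      rw [Int.cofinite_eq, eventually_sup] at h1
      have h2 (n : ℤ) : k⁻¹ * w ^ n = v ^ n * k⁻¹ := by rw [← hk, conj_zpow]; group
      refine ⟨k, True, ?_, ?_⟩
      · filter_upwards [h1.2, eventually_gt_atTop 0] with n hn hn'
        rw [h2, hn]; simpa using hn'
      · filter_upwards [h1.1, eventually_lt_atBot 0] with n hn hn'
        rw [h2, hn]; simpa using hn'.le
    · obtain ⟨k, hk⟩ := isConj_iff.1 hconj
      have h1 := hfin k
      rw [Int.cofinite_eq, eventually_sup] at h1
      have h2 (n : ℤ) : k⁻¹ * w ^ n = v ^ (-n) * k⁻¹ := by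
        rw [← inv_inv w, ← hk, inv_zpow', conj_zpow]; group
      refine ⟨k, False, ?_, ?_⟩
      · filter_upwards [tendsto_neg_atTop_atBot.eventually h1.1, eventually_gt_atTop 0]
          with n hn hn'
        rw [h2, hn]; simpa using hn'.le
      · filter_upwards [tendsto_neg_atBot_atTop.eventually h1.2, eventually_lt_atBot 0]
          with n hn hn'
        rw [h2, hn]; simpa using hn'
  obtain ⟨k, a, htop, hbot⟩ := key
  -- A time at which the orbit crosses the edge.
  obtain ⟨n, hn⟩ : ∃ n : ℤ, ¬ (Ahead hT e (k⁻¹ * w ^ n) (G.src e) ↔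
      Ahead hT e (k⁻¹ * w ^ (n + 1)) (G.src e)) := by
    by_contra! hcon
    have hconst (n : ℤ) : Ahead hT e (k⁻¹ * w ^ n) (G.src e) ↔
        Ahead hT e (k⁻¹ * w ^ (0 : ℤ)) (G.src e) := by
      induction n using Int.induction_on with
      | zero => rfl
      | succ i ih => rw [← hcon, ih]
      | pred i ih => rw [hcon, sub_add_cancel, ih]
    obtain ⟨i, hi⟩ := htop.exists
    obtain ⟨j, hj⟩ := hbot.exists
    rw [hconst] at hi hj
    tauto
  have hshift (i : ℤ) : (w ^ (-n) * k)⁻¹ * w ^ i = k⁻¹ * w ^ (i + n) := by group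
  refine ⟨w ^ (-n) * k, isInitialSubword_of_ahead_ne hT e _ _ (G.src e) ?_, a, ?_, ?_⟩
  · have h0 := hshift 0
    have h1 := hshift 1
    rw [zpow_zero, mul_one, zero_add] at h0
    rw [zpow_one, add_comm] at h1
    rw [h1, h0]
    exact hn
  · simp only [hshift]
    exact (tendsto_atTop_add_const_right _ n tendsto_id).eventually htop
  · simp only [hshift]
    exact (tendsto_atBot_add_const_right _ n tendsto_id).eventually hbot

/-! ### Separation of two axes -/

/-- A translate of the lift of `e` on the axis of `w₁`, far in the direction of `w₁`, has all the
vertices `(w₂ ^ i, v)` on the side of `(1, v)`: such a translate that separates `(w₂ ^ i, v)` from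
`(1, v)` has the form `w₂ ^ j z` with `z` in a finite set, and two of the form `w₂ ^ j z` with the
same `z` would produce a relation between powers of `w₁` and `w₂`. -/
theorem eventually_ahead_iff (hT : G.IsSpanningTree T) (e : E) {w₁ w₂ : Pi T} (γ : Pi T)
    (hw : ¬ PowersOfCommonWord w₁ w₂) (v : V) :
    ∀ᶠ p : ℕ in atTop, ∀ (i : ℕ) (v' : V),
      (Ahead hT e (γ⁻¹ * w₁ ^ (-(p : ℤ)) * w₂ ^ i) v' ↔ Ahead hT e (γ⁻¹ * w₁ ^ (-(p : ℤ))) v) := by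
  let Z : Set (Pi T) := {h | IsInitialSubword h w₂} ∪ {1}
  have hZ : Z.Finite := (finite_setOf_isInitialSubword w₂).union (Set.finite_singleton 1)
  let B : Set ℕ := {p | ∃ z ∈ Z, ∃ i : ℤ, w₁ ^ (p : ℤ) * γ = w₂ ^ i * z}
  have hB : B.Finite := by
    choose! z hz i hi using fun (p : ℕ) (hp : p ∈ B) ↦ hp
    refine Set.Finite.of_finite_image (f := z) (hZ.subset ?_) ?_
    · rintro _ ⟨p, hp, rfl⟩
      exact hz p hp
    · intro p hp p' hp' hpp'
      by_contra hne
      refine hw (powersOfCommonWord_of_zpow_eq_zpow w₁ w₂ (a := p - p') (b := i p - i p')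
        (by omega) ?_)
      have h1 := hi p hp
      have h2 := hi p' hp'
      rw [hpp'] at h1
      have h3 : w₁ ^ ((p : ℤ) - p') = (w₁ ^ (p : ℤ) * γ) * (w₁ ^ (p' : ℤ) * γ)⁻¹ := by group
      rw [h3, h1, h2]; group
  have hev : ∀ᶠ p : ℕ in atTop, p ∉ B := by
    rw [← Nat.cofinite_eq_atTop]
    exact hB.compl_mem_cofinite
  filter_upwards [hev] with p hp i v'
  set h := w₁ ^ (p : ℤ) * γ with hh
  have hinv : γ⁻¹ * w₁ ^ (-(p : ℤ)) = h⁻¹ := by rw [hh]; group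
  rw [hinv]
  have hv (i : ℕ) : Ahead hT e (h⁻¹ * w₂ ^ i) v ↔ Ahead hT e h⁻¹ v := by
    induction i with
    | zero => simp
    | succ i ih =>
      rw [← ih]
      by_contra hne
      refine hp ⟨(w₂ ^ i)⁻¹ * h, .inl (isInitialSubword_of_ahead_ne hT e _ _ v ?_), i, ?_⟩
      · rw [mul_inv_rev, inv_inv, mul_assoc, ← pow_succ]
        tauto
      · rw [← hh, zpow_natCast, mul_inv_cancel_left]
  rw [← hv i]
  refine ahead_congr hT e (fun h1 ↦ hp ⟨1, .inr rfl, i, ?_⟩) _ _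
  rw [← hh, mul_one, zpow_natCast]
  exact inv_mul_eq_one.1 h1

/-- If `e` belongs to `w₁`, then for an initial subword `γ` of `w₁` and all large `p` and `j`, the
translate of the lift of `e` by `w₁ ^ p * γ` separates the vertices over `w₁ ^ (p + j)` from those
over powers of `w₂`. -/
theorem exists_initialSubword_separating (hT : G.IsSpanningTree T) {e : E} {x₀ : V} {w₁ w₂ : Pi T}
    (hb : G.Belongs T x₀ e w₁) (hw : ¬ PowersOfCommonWord w₁ w₂) :
    ∃ γ : Pi T, IsInitialSubword γ w₁ ∧ ∃ K : ℕ, ∀ p ≥ K, ∀ j ≥ K, ∀ (i : ℕ) (v v' : V),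
      ¬ (Ahead hT e ((w₁ ^ p * γ)⁻¹ * w₁ ^ (p + j)) v ↔
        Ahead hT e ((w₁ ^ p * γ)⁻¹ * w₂ ^ i) v') := by
  obtain ⟨γ, hγ, a, htop, hbot⟩ := hb.exists_initialSubword hT
  refine ⟨γ, hγ, ?_⟩
  have hw1 : w₁ ≠ 1 := by
    rintro rfl
    exact hw ⟨w₂, 0, 1, by simp, by simp⟩
  have hne : ∀ᶠ n : ℤ in atTop, γ⁻¹ * w₁ ^ n ≠ 1 := by
    have h1 : {n : ℤ | w₁ ^ n = γ}.Finite :=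
      (Set.finite_singleton γ).preimage (zpow_injective hw1).injOn
    have h2 := h1.compl_mem_cofinite
    rw [Int.cofinite_eq] at h2
    filter_upwards [(mem_sup.1 h2).2] with n hn h3
    exact hn (inv_mul_eq_one.1 h3).symm
  have hcast : Tendsto (fun n : ℕ ↦ (n : ℤ)) atTop atTop := tendsto_natCast_atTop_atTop
  have hj := hcast.eventually (htop.and hne)
  have hp := (tendsto_neg_atTop_atBot.comp hcast).eventually hbot
  obtain ⟨K, hK⟩ := eventually_atTop.1
    (hj.and (hp.and (eventually_ahead_iff hT e γ hw (G.src e))))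
  refine ⟨K, fun p hp j hj i v v' ↦ ?_⟩
  have h1 := (hK j hj).1
  have h2 := (hK p hp).2
  have e1 : (w₁ ^ p * γ)⁻¹ * w₁ ^ (p + j) = γ⁻¹ * w₁ ^ (j : ℤ) := by
    rw [zpow_natCast, pow_add]; group
  have e2 : (w₁ ^ p * γ)⁻¹ = γ⁻¹ * w₁ ^ (-(p : ℤ)) := by
    rw [zpow_neg, zpow_natCast, mul_inv_rev]
  rw [e1, e2, h2.2, ahead_congr hT e h1.2 v (G.src e), h1.1]
  have h3 := h2.1
  simp only [Function.comp_apply] at h3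
  rw [h3]
  tauto

end DirGraph

namespace DirGraph

/-! ### The topology of a graph -/

section Space

variable {V E : Type*} {G : DirGraph V E}

theorem edgeMap_zero (e : E) : G.edgeMap e 0 = .vertex (G.src e) := by simp [edgeMap]

theorem edgeMap_one (e : E) : G.edgeMap e 1 = .vertex (G.tgt e) := by simp [edgeMap]

theorem edgeMap_of_mem (e : E) {t : unitInterval} (h : (t : ℝ) ∈ Set.Ioo (0 : ℝ) 1) :
    G.edgeMap e t = .inner e ⟨t, h⟩ := by simp only [edgeMap, dif_pos h]

theorem eq_zero_or_eq_one_or_mem_Ioo (t : unitInterval) :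
    t = 0 ∨ t = 1 ∨ (t : ℝ) ∈ Set.Ioo (0 : ℝ) 1 := by
  rcases eq_or_ne t 0 with h | h
  · exact .inl h
  rcases eq_or_ne t 1 with h' | h'
  · exact .inr (.inl h')
  · exact .inr (.inr ⟨unitInterval.pos_iff_ne_zero.2 h, unitInterval.lt_one_iff_ne_one.2 h'⟩)

/-- Continuity for the weak topology is checked on closed edges. -/
theorem continuous_space_iff {X : Type*} [TopologicalSpace X] {φ : G.Space → X} :
    Continuous φ ↔ ∀ e, Continuous fun t ↦ φ (G.edgeMap e t) := by
  refine continuous_iSup_dom.trans (forall_congr' fun e ↦ ?_)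
  exact continuous_coinduced_dom

theorem continuous_edgeMap (e : E) : Continuous (G.edgeMap e) :=
  continuous_space_iff.1 continuous_id e

theorem isOpen_space_iff {s : Set G.Space} : IsOpen s ↔ ∀ e, IsOpen (G.edgeMap e ⁻¹' s) :=
  isOpen_iSup_iff.trans (forall_congr' fun _ ↦ isOpen_coinduced)

variable (G) in
/-- The open star of radius one half around a vertex. -/
def openStar (v : V) : Set G.Space
  | .vertex u => u = v
  | .inner e t => (G.src e = v ∧ (t : ℝ) < 1 / 2) ∨ (G.tgt e = v ∧ 1 / 2 < (t : ℝ))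

theorem isOpen_openStar (v : V) : IsOpen (G.openStar v) := by
  refine isOpen_space_iff.2 fun e ↦ ?_
  have : G.edgeMap e ⁻¹' G.openStar v =
      {t : unitInterval | G.src e = v ∧ (t : ℝ) < 1 / 2} ∪
        {t : unitInterval | G.tgt e = v ∧ 1 / 2 < (t : ℝ)} := by
    ext t
    rcases eq_zero_or_eq_one_or_mem_Ioo t with rfl | rfl | h
    · rw [Set.mem_preimage, edgeMap_zero]
      change G.src e = v ↔ _
      norm_num
    · rw [Set.mem_preimage, edgeMap_one]
      change G.tgt e = v ↔ _
      norm_num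
    · rw [Set.mem_preimage, edgeMap_of_mem _ h]
      rfl
  rw [this]
  refine IsOpen.union ?_ ?_
  · exact isOpen_const.inter (isOpen_lt continuous_subtype_val continuous_const)
  · exact isOpen_const.inter (isOpen_lt continuous_const continuous_subtype_val)

variable (G) in
/-- The set of interior points of an edge. -/
def openEdge (e : E) : Set G.Space
  | .vertex _ => False
  | .inner d _ => d = e

theorem isOpen_openEdge (e : E) : IsOpen (G.openEdge e) := by
  refine isOpen_space_iff.2 fun d ↦ ?_
  have : G.edgeMap d ⁻¹' G.openEdge e = {t : unitInterval | d = e ∧ 0 < t ∧ t < 1} := by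
    ext t
    rcases eq_zero_or_eq_one_or_mem_Ioo t with rfl | rfl | h
    · rw [Set.mem_preimage, edgeMap_zero]
      change False ↔ _
      simp
    · rw [Set.mem_preimage, edgeMap_one]
      change False ↔ _
      simp
    · rw [Set.mem_preimage, edgeMap_of_mem _ h]
      exact ⟨fun h' ↦ ⟨h', h.1, h.2⟩, fun h' ↦ h'.1⟩
  rw [this]
  exact isOpen_const.inter (isOpen_Ioo (a := (0 : unitInterval)))

/-- The extension of a function on the vertices that is affine on every edge. -/
def affineExtension (φ : V → ℝ) : G.Space → ℝ
  | .vertex v => φ v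
  | .inner e t => (1 - t) * φ (G.src e) + t * φ (G.tgt e)

theorem continuous_affineExtension (φ : V → ℝ) : Continuous (affineExtension (G := G) φ) := by
  refine continuous_space_iff.2 fun e ↦ ?_
  have : (fun t ↦ affineExtension φ (G.edgeMap e t)) =
      fun t : unitInterval ↦ (1 - (t : ℝ)) * φ (G.src e) + t * φ (G.tgt e) := by
    ext t
    rcases eq_zero_or_eq_one_or_mem_Ioo t with rfl | rfl | h
    · simp [edgeMap_zero, affineExtension]
    · simp [edgeMap_one, affineExtension]
    · simp [edgeMap_of_mem _ h, affineExtension]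
  rw [this]
  fun_prop

end Space

/-! ### Covering transformations and lifts of homotopies -/

section Cover

variable {V E : Type*} {G : DirGraph V E} {T : Set E}

theorem proj_lift (x : G.Space) : proj (lift (T := T) x) = x := by cases x <;> rfl

theorem proj_deck (g : Pi T) (x : (G.cover T).Space) : proj (deck g x) = proj x := by
  cases x <;> rfl

theorem deck_deck (g h : Pi T) (x : (G.cover T).Space) : deck g (deck h x) = deck (g * h) x := by
  cases x <;> simp [deck, mul_assoc]

theorem deck_one (x : (G.cover T).Space) : deck 1 x = x := by
  cases x <;> simp [deck]

theorem deck_edgeMap (g : Pi T) (d : Pi T × E) (t : unitInterval) :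
    deck g ((G.cover T).edgeMap d t) = (G.cover T).edgeMap (g * d.1, d.2) t := by
  rcases eq_zero_or_eq_one_or_mem_Ioo t with rfl | rfl | h
  · simp [edgeMap_zero, deck, cover]
  · simp [edgeMap_one, deck, cover, mul_assoc]
  · simp [edgeMap_of_mem _ h, deck]

theorem continuous_deck (g : Pi T) : Continuous (deck (G := G) g) := by
  refine continuous_space_iff.2 fun d ↦ ?_
  simp only [deck_edgeMap]
  exact continuous_edgeMap _

theorem lift_edgeMap {e : E} (he : e ∈ T) (t : unitInterval) :
    lift (G.edgeMap e t) = (G.cover T).edgeMap (1, e) t := by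
  rcases eq_zero_or_eq_one_or_mem_Ioo t with rfl | rfl | h
  · simp [edgeMap_zero, lift, cover]
  · simp [edgeMap_one, lift, cover, theta_of_mem he]
  · simp [edgeMap_of_mem _ h, lift]

/-- Together with local injectivity, this gives uniqueness of path lifting. -/
theorem isSeparatedMap_proj : IsSeparatedMap (proj (G := G) (T := T)) := by
  rintro (a | ⟨d, t⟩) (b | ⟨d', t'⟩) h hne
  · refine ⟨_, _, isOpen_openStar a, isOpen_openStar b, rfl, rfl, ?_⟩
    rw [Set.disjoint_left]
    have hab : a ≠ b := fun h ↦ hne (h ▸ rfl)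
    rintro (c | ⟨d, t⟩) h1 h2
    · exact hab (Eq.trans (Eq.symm h1) h2)
    · rcases h1 with ⟨h1, h3⟩ | ⟨h1, h3⟩ <;> rcases h2 with ⟨h2, h4⟩ | ⟨h2, h4⟩
      · exact hab (h1.symm.trans h2)
      · linarith
      · linarith
      · exact hab (h1.symm.trans h2)
  · cases h
  · cases h
  · simp only [proj, Space.inner.injEq] at h
    refine ⟨_, _, isOpen_openEdge d, isOpen_openEdge d', rfl, rfl, ?_⟩
    rw [Set.disjoint_left]
    rintro (c | ⟨d'', s⟩) h1 h2
    · exact h1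
    · refine hne ?_
      obtain rfl : d = d' := Eq.trans (Eq.symm h1) h2
      rw [h.2]

theorem isLocallyInjective_proj : IsLocallyInjective (proj (G := G) (T := T)) := by
  rintro (a | ⟨d, t⟩)
  · refine ⟨_, isOpen_openStar a, rfl, ?_⟩
    rintro (b | ⟨⟨g, e⟩, t⟩) h1 (b' | ⟨⟨g', e'⟩, t'⟩) h2 h
    · exact congrArg _ (Eq.trans h1 (Eq.symm h2))
    · cases h
    · cases h
    · simp only [proj, Space.inner.injEq] at h
      obtain ⟨rfl, rfl⟩ := h
      suffices g = g' by rw [this]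
      rcases h1 with ⟨h1, h3⟩ | ⟨h1, h3⟩ <;> rcases h2 with ⟨h2, h4⟩ | ⟨h2, h4⟩
      · exact congrArg Prod.fst (h1.trans h2.symm)
      · linarith
      · linarith
      · exact mul_right_cancel (congrArg Prod.fst (h1.trans h2.symm))
  · refine ⟨_, isOpen_openEdge d, rfl, ?_⟩
    rintro (b | ⟨d', t⟩) h1 (b' | ⟨d'', t'⟩) h2 h
    · exact h1.elim
    · exact h1.elim
    · exact h2.elim
    · simp only [proj, Space.inner.injEq] at h
      obtain rfl : d' = d'' := Eq.trans h1 (Eq.symm h2)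
      rw [h.2]

theorem IsLiftAlong.semiconj {f : C(G.Space, G.Space)}
    {H : (ContinuousMap.id G.Space).Homotopy f}
    {ft : C((G.cover T).Space, (G.cover T).Space)} (hft : IsLiftAlong H ft) :
    Function.Semiconj proj ft f := by
  obtain ⟨Ht, hHt⟩ := hft
  intro x
  simpa using hHt 1 x

/-- The lift along a homotopy commutes with covering transformations: the lifted homotopy and its
translate lift the same paths, from the same starting points. -/
theorem IsLiftAlong.commute_deck {f : C(G.Space, G.Space)}
    {H : (ContinuousMap.id G.Space).Homotopy f}
    {ft : C((G.cover T).Space, (G.cover T).Space)} (hft : IsLiftAlong H ft) (g : Pi T) :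
    Function.Commute ft (deck g) := by
  obtain ⟨Ht, hHt⟩ := hft
  intro x
  have key : (fun t ↦ Ht (t, deck g x)) = fun t ↦ deck g (Ht (t, x)) := by
    refine isSeparatedMap_proj.eq_of_comp_eq isLocallyInjective_proj (by fun_prop)
      ((continuous_deck g).comp (by fun_prop)) ?_ 0 (by simp)
    ext t
    simp [hHt, proj_deck]
  simpa using congrFun key 1

end Cover

/-! ### Crossing an edge and periodic points -/

section Crossing

variable {V E : Type*} {G : DirGraph V E} {T : Set E}

/-- Let a path in the universal cover, parametrized by the unit interval, join vertices on
different sides of the chosen lift of `e`. Then it meets this lift at a point with the same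
parameter. -/
theorem exists_eq_edgeMap_of_ahead_ne (no_loops : ∀ e : E, G.src e ≠ G.tgt e)
    (hT : G.IsSpanningTree T) (e : E) {F : unitInterval → (G.cover T).Space} (hF : Continuous F)
    {a b : Pi T × V} (ha : F 0 = .vertex a) (hb : F 1 = .vertex b)
    (hab : ¬ (Ahead hT e a.1 a.2 ↔ Ahead hT e b.1 b.2)) :
    ∃ t, F t = (G.cover T).edgeMap (1, e) t := by
  classical
  -- A height on the cover that extends the parameter of the edge and takes values outside the
  -- unit interval off the edge.
  let φ (c : Pi T × V) : ℝ :=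
    if Ahead hT e c.1 c.2 then (if c = (G.cover T).tgt (1, e) then 1 else 2)
    else (if c = (G.cover T).src (1, e) then 0 else -1)
  have hsrc : ¬ Ahead hT e ((G.cover T).src (1, e)).1 ((G.cover T).src (1, e)).2 :=
    not_ahead_src hT e
  have htgt : Ahead hT e ((G.cover T).tgt (1, e)).1 ((G.cover T).tgt (1, e)).2 := by
    simpa [cover] using ahead_tgt hT e
  have hφ_ahead {c} (h : Ahead hT e c.1 c.2) : 1 ≤ φ c := by
    simp only [φ, if_pos h]; split_ifs <;> norm_num
  have hφ_behind {c} (h : ¬ Ahead hT e c.1 c.2) : φ c ≤ 0 := by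
    simp only [φ, if_neg h]; split_ifs <;> norm_num
  have hφ_one {c} (h : Ahead hT e c.1 c.2) (h1 : φ c ≤ 1) : c = (G.cover T).tgt (1, e) := by
    by_contra hc
    simp only [φ, if_pos h, if_neg hc] at h1
    norm_num at h1
  have hφ_zero {c} (h : ¬ Ahead hT e c.1 c.2) (h1 : 0 ≤ φ c) : c = (G.cover T).src (1, e) := by
    by_contra hc
    simp only [φ, if_neg h, if_neg hc] at h1
    norm_num at h1
  have hloop (d) : (G.cover T).src d ≠ (G.cover T).tgt d :=
    fun h ↦ no_loops d.2 (congrArg Prod.snd h)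
  have hφsrc : φ ((G.cover T).src (1, e)) = 0 := by simp only [φ, if_neg hsrc, if_true]
  have hφtgt : φ ((G.cover T).tgt (1, e)) = 1 := by simp only [φ, if_pos htgt, if_true]
  have hpoint (x : (G.cover T).Space) (t : unitInterval) (hx : affineExtension φ x = t) :
      x = (G.cover T).edgeMap (1, e) t := by
    obtain ⟨ht0, ht1⟩ := t.2
    cases x with
    | vertex c =>
      simp only [affineExtension] at hx
      by_cases hc : Ahead hT e c.1 c.2
      · obtain rfl := hφ_one hc (hx ▸ ht1)
        obtain rfl : t = 1 := Subtype.ext (by rw [← hx, hφtgt]; rfl)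
        rw [edgeMap_one]
      · obtain rfl := hφ_zero hc (hx ▸ ht0)
        obtain rfl : t = 0 := Subtype.ext (by rw [← hx, hφsrc]; rfl)
        rw [edgeMap_zero]
    | inner d s =>
      obtain ⟨s, hs0, hs1⟩ := s
      simp only [affineExtension] at hx
      by_cases hd : d = (1, e)
      · subst hd
        rw [hφsrc, hφtgt] at hx
        obtain rfl : s = t := by linarith
        exact (edgeMap_of_mem _ ⟨hs0, hs1⟩).symm
      · exfalso
        have hside : Ahead hT e ((G.cover T).tgt d).1 ((G.cover T).tgt d).2 ↔
            Ahead hT e ((G.cover T).src d).1 ((G.cover T).src d).2 :=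
          ahead_edge hT e fun h ↦ hd (Prod.ext h.1 h.2)
        by_cases hc : Ahead hT e ((G.cover T).src d).1 ((G.cover T).src d).2
        · have h1 := hφ_ahead hc
          have h2 := hφ_ahead (hside.2 hc)
          refine hloop d ((hφ_one hc ?_).trans (hφ_one (hside.2 hc) ?_).symm) <;> nlinarith
        · have hc' := fun h ↦ hc (hside.1 h)
          have h1 := hφ_behind hc
          have h2 := hφ_behind hc'
          refine hloop d ((hφ_zero hc ?_).trans (hφ_zero hc' ?_).symm) <;> nlinarith
  suffices ∃ t : unitInterval, affineExtension φ (F t) = t by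
    obtain ⟨t, ht⟩ := this
    exact ⟨t, hpoint _ _ ht⟩
  have hcont : Continuous fun t ↦ affineExtension φ (F t) :=
    (continuous_affineExtension φ).comp hF
  have h0 : affineExtension φ (F 0) = φ a := by rw [ha]; rfl
  have h1 : affineExtension φ (F 1) = φ b := by rw [hb]; rfl
  have h0' : affineExtension φ (F 0) - ((0 : unitInterval) : ℝ) = φ a := by rw [h0]; simp
  have h1' : affineExtension φ (F 1) - ((1 : unitInterval) : ℝ) = φ b - 1 := by rw [h1]; simp
  have hcont' : Continuous fun t : unitInterval ↦ affineExtension φ (F t) - (t : ℝ) :=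
    hcont.sub continuous_subtype_val
  by_cases hA : Ahead hT e a.1 a.2
  · have hB : ¬ Ahead hT e b.1 b.2 := by tauto
    have := hφ_ahead hA
    have := hφ_behind hB
    obtain ⟨t, ht⟩ := mem_range_of_exists_le_of_exists_ge (c := (0 : ℝ)) hcont'
      ⟨1, h1'.trans_le (by linarith)⟩ ⟨0, le_of_le_of_eq (by linarith) h0'.symm⟩
    exact ⟨t, sub_eq_zero.1 ht⟩
  · have hB : Ahead hT e b.1 b.2 := by tauto
    have := hφ_behind hA
    have := hφ_ahead hB
    obtain ⟨t, ht⟩ := mem_range_of_exists_le_of_exists_ge (c := (0 : ℝ)) hcont'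
      ⟨0, h0'.trans_le (by linarith)⟩ ⟨1, le_of_le_of_eq (by linarith) h1'.symm⟩
    exact ⟨t, sub_eq_zero.1 ht⟩

/-- If the lift of `fᵠ` maps the chosen lift of `e` to a path that crosses its translate by `h`,
then `e` contains a periodic point with rotation element `h^{1/q}`. -/
theorem exists_hasRotationElement (no_loops : ∀ e : E, G.src e ≠ G.tgt e)
    (hT : G.IsSpanningTree T) {f : C(G.Space, G.Space)}
    {H : (ContinuousMap.id G.Space).Homotopy f}
    {ft : C((G.cover T).Space, (G.cover T).Space)} (hft : IsLiftAlong H ft) {e : E} (he : e ∈ T)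
    {q : ℕ} (hq : 0 < q) {g₁ g₂ h : Pi T}
    (h₁ : ft^[q] (.vertex (1, G.src e)) = .vertex (g₁, G.src e))
    (h₂ : ft^[q] (.vertex (1, G.tgt e)) = .vertex (g₂, G.tgt e))
    (hne : ¬ (Ahead hT e (h⁻¹ * g₁) (G.src e) ↔ Ahead hT e (h⁻¹ * g₂) (G.tgt e))) :
    ∃ x ∈ Set.range (G.edgeMap e), HasRotationElement f ft x h q := by
  let F (t : unitInterval) : (G.cover T).Space := deck h⁻¹ (ft^[q] (lift (G.edgeMap e t)))
  have hF : Continuous F := by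
    refine (continuous_deck _).comp ((ft.continuous.iterate q).comp ?_)
    simp only [lift_edgeMap he]
    exact continuous_edgeMap _
  have hF0 : F 0 = .vertex (h⁻¹ * g₁, G.src e) := by
    simp only [F, edgeMap_zero, lift, h₁, deck]
  have hF1 : F 1 = .vertex (h⁻¹ * g₂, G.tgt e) := by
    simp only [F, edgeMap_one, lift, h₂, deck]
  obtain ⟨t, ht⟩ := exists_eq_edgeMap_of_ahead_ne no_loops hT e hF hF0 hF1 hne
  have hrot : ft^[q] (lift (G.edgeMap e t)) = deck h (lift (G.edgeMap e t)) := by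
    have := congrArg (deck h) ht
    rwa [deck_deck, mul_inv_cancel, deck_one, ← lift_edgeMap he] at this
  refine ⟨_, ⟨t, rfl⟩, hq, ?_, hrot⟩
  have := hft.semiconj.iterate_right q (lift (G.edgeMap e t))
  rw [hrot, proj_deck, proj_lift] at this
  exact this.symm

theorem HasRotationElement.iterate_mul {f : C(G.Space, G.Space)}
    {H : (ContinuousMap.id G.Space).Homotopy f}
    {ft : C((G.cover T).Space, (G.cover T).Space)} (hft : IsLiftAlong H ft) {v : V} {w : Pi T}
    {m : ℕ} (h : HasRotationElement f ft (.vertex v) w m) (k : ℕ) :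
    ft^[m * k] (.vertex (1, v)) = .vertex (w ^ k, v) := by
  induction k with
  | zero => simp
  | succ k ih =>
    have h1 : ft^[m] (.vertex (1, v)) = .vertex (w, v) := by
      have := h.2.2
      simpa [lift, deck] using this
    have h2 : Space.vertex (w ^ k, v) = deck (G := G) (w ^ k) (.vertex (1, v)) := by simp [deck]
    rw [Nat.mul_succ, add_comm, Function.iterate_add_apply, ih, h2,
      (hft.commute_deck (w ^ k)).iterate_left m, h1, deck, pow_succ]

end Crossing

/-- Every rational number in `(0, 1/m)` is a fraction `p / q` whose denominator is a common multiple
of `m` and `n`, with both `p` and `q / m - p` large. -/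
theorem exists_large_fraction {m n : ℕ} (hm : 0 < m) (hn : 0 < n) (K : ℕ) {r : ℚ} (hr : 0 < r)
    (hrm : r < 1 / (m : ℚ)) : ∃ p q j i : ℕ, 0 < q ∧ r = (p : ℚ) / q ∧ K ≤ p ∧ K ≤ j ∧
      q = m * (p + j) ∧ q = n * i := by
  obtain ⟨a, ha⟩ := Int.eq_ofNat_of_zero_le (Rat.num_nonneg.2 hr.le)
  have hr' : r = (a : ℚ) / r.den := by
    conv_lhs => rw [← Rat.num_div_den r, ha]
    simp
  have hb : 0 < r.den := r.den_pos
  generalize r.den = b at hr' hb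
  subst hr'
  have hmQ : (0 : ℚ) < m := by exact_mod_cast hm
  have hbQ : (0 : ℚ) < b := by exact_mod_cast hb
  have ha0 : 0 < a := by
    rcases Nat.eq_zero_or_pos a with rfl | h
    · simp at hr
    · exact h
  have hab : m * a < b := by
    rw [div_lt_div_iff₀ hbQ hmQ] at hrm
    have : a * m < 1 * b := by exact_mod_cast hrm
    linarith [mul_comm a m]
  obtain ⟨c, rfl⟩ := Nat.exists_eq_add_of_lt hab
  refine ⟨m * n * a * (K + 1), m * n * (m * a + c + 1) * (K + 1), n * (c + 1) * (K + 1),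
    m * (m * a + c + 1) * (K + 1), by positivity, ?_, ?_, ?_, by ring, by ring⟩
  · have : (n : ℚ) ≠ 0 := by exact_mod_cast hn.ne'
    have : (K : ℚ) + 1 ≠ 0 := by positivity
    push_cast
    field_simp
  · exact (Nat.le_succ K).trans (Nat.le_mul_of_pos_left _ (by positivity))
  · exact (Nat.le_succ K).trans (Nat.le_mul_of_pos_left _ (by positivity))

end DirGraph

theorem mainTheorem3 {V E : Type*} [Finite V] [Finite E] (G : DirGraph V E)
    (no_loops : ∀ e : E, G.src e ≠ G.tgt e)
    (T : Set E) (hT : G.IsSpanningTree T) (x₀ : V)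
    (f : C(G.Space, G.Space)) (hf : G.IsVertexMap f)
    (H : (ContinuousMap.id G.Space).Homotopy f)
    (ft : C((G.cover T).Space, (G.cover T).Space)) (hft : DirGraph.IsLiftAlong H ft)
    (e : E) (he : e ∈ T) (w₁ w₂ : DirGraph.Pi T) (m n : ℕ)
    (h₁ : DirGraph.HasRotationElement f ft (.vertex (G.src e)) w₁ m)
    (h₂ : DirGraph.HasRotationElement f ft (.vertex (G.tgt e)) w₂ n)
    (hb₁ : G.Belongs T x₀ e w₁) (hb₂ : G.Belongs T x₀ e w₂)
    (hw : ¬ DirGraph.PowersOfCommonWord w₁ w₂) :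
    ∃ γ₁ γ₂ : DirGraph.Pi T,
      DirGraph.IsInitialSubword γ₁ w₁ ∧ DirGraph.IsInitialSubword γ₂ w₂ ∧
      ∀ r s : ℚ, 0 < r → r < 1 / (m : ℚ) → 0 < s → s < 1 / (n : ℚ) →
        ∃ p q p' q' : ℕ, 0 < q ∧ 0 < q' ∧ r = (p : ℚ) / q ∧ s = (p' : ℚ) / q' ∧
          (∃ x ∈ Set.range (G.edgeMap e),
            DirGraph.HasRotationElement f ft x (w₁ ^ p * γ₁) q) ∧
          (∃ y ∈ Set.range (G.edgeMap e),
            DirGraph.HasRotationElement f ft y (w₂ ^ p' * γ₂) q') := by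
  have hw' : ¬ DirGraph.PowersOfCommonWord w₂ w₁ :=
    fun ⟨w, k₁, k₂, h₁, h₂⟩ ↦ hw ⟨w, k₂, k₁, h₂, h₁⟩
  obtain ⟨γ₁, hγ₁, K₁, hK₁⟩ := DirGraph.exists_initialSubword_separating hT hb₁ hw
  obtain ⟨γ₂, hγ₂, K₂, hK₂⟩ := DirGraph.exists_initialSubword_separating hT hb₂ hw'
  refine ⟨γ₁, γ₂, hγ₁, hγ₂, fun r s hr hrm hs hsn ↦ ?_⟩
  -- Fractions may be expanded at will, so `p` and `q / m - p` can be taken large.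
  obtain ⟨p, q, j, i, hq, hrpq, hp, hj, hqm, hqn⟩ :=
    DirGraph.exists_large_fraction h₁.1 h₂.1 K₁ hr hrm
  obtain ⟨p', q', j', i', hq', hspq, hp', hj', hqn', hqm'⟩ :=
    DirGraph.exists_large_fraction h₂.1 h₁.1 K₂ hs hsn
  refine ⟨p, q, p', q', hq, hq', hrpq, hspq, ?_, ?_⟩
  · refine DirGraph.exists_hasRotationElement no_loops hT hft he hq
      (g₁ := w₁ ^ (p + j)) (g₂ := w₂ ^ i) ?_ ?_ (hK₁ p hp j hj i _ _)
    · rw [hqm]; exact h₁.iterate_mul hft _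
    · rw [hqn]; exact h₂.iterate_mul hft _
  · refine DirGraph.exists_hasRotationElement no_loops hT hft he hq'
      (g₁ := w₁ ^ i') (g₂ := w₂ ^ (p' + j')) ?_ ?_
      (fun h ↦ hK₂ p' hp' j' hj' i' _ _ h.symm)
    · rw [hqm']; exact h₁.iterate_mul hft _
    · rw [hqn']; exact h₂.iterate_mul hft _
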